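/- Let $q$ be a prime power, let $n,b\in\mathbb N$, and for a vector space $V$ let $\mathcal L(V)$ be the set of its linear subspaces. A $b$-local profile is a sequence $\mathcal V=(\mathcal V_1,\dots,\mathcal V_n)\in\mathcal L(\mathbb F_q^b)^n$. A code $\mathcal C\subseteq\mathbb F_q^n$ contains $\mathcal V$ if there is a matrix $A\in\mathbb F_q^{n\times b}$ with pairwise distinct columns, all belonging to $\mathcal C$, whose $i$-th row belongs to $\mathcal V_i$ for every $1\le i\le n$. A property $\mathcal P$ (a family of codes in $\mathbb F_q^n$) is $b$-LCL with associated profile family $\mathcal F\subseteq\mathcal L(\mathbb F_q^b)^n$ if $\mathcal P$ is the set of all codes $\mathcal C\subseteq\mathbb F_q^n$ that contain some $\mathcal V\in\mathcal F$; a code satisfies $\mathcal P$ if it belongs to $\mathcal P$. Let $\mathcal L_{\mathrm{dist}}(\mathbb F_q^b)$ be the set of all $U\in\mathcal L(\mathbb F_q^b)$ such that for all $1\le i<j\le b$ there is $x\in U$ with $x_i\ne x_j$. The threshold rate of $\mathcal P$ (with respect to $\mathcal F$) is $$R_{\mathcal P}=\min_{\mathcal V\in\mathcal F}\ \min_{U\in\mathcal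 L_{\mathrm{dist}}(\mathbb F_q^b)}\ \max_{W\subsetneq U}\left(1-\frac{\sum_{i=1}^n\bigl(\dim(\mathcal V_i\cap U)-\dim(\mathcal V_i\cap W)\bigr)}{n(\dim U-\dim W)}\right),$$ where $W$ ranges over the proper linear subspaces of $U$, with the conventions $\max\emptyset=-\infty$ and $\min\emptyset=+\infty$. Theorem (Reduction from random linear codes to random Reed–Solomon codes). Let $\mathcal P$ be a $b$-LCL property of codes in $\mathbb F_q^n$ with associated profile family $\mathcal F$, let $\varepsilon$ and $R\le R_{\mathcal P}-\varepsilon$ be real numbers such that $k=Rn$ is a non-negative integer, and assume that $q>kb$ and $\varepsilon n\ge 2b(b+1)$. Let $\alpha_1,\dots,\alpha_n$ be independent and uniformly distributed in $\mathbb F_q$, and let $$\mathcal C=\{(f(\alpha_1),\dots,f(\alpha_n)) : f\in\mathbb F_q[X],\ \deg f<k\}.$$ Then $$\Pr[\mathcal C\text{ satisfies }\mathcal P]\le\left(\frac{(4b)^{4b}\,k}{\varepsilon q}\right)^{\frac{\varepsilon n}{2b}}\cdot|\mathcal F|.$$ (For $b=0$ the exponent $\varepsilon n/(2b)$ is not defined;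 the hypotheses then force $\mathcal F=\emptyset$, and the claim reads $\Pr[\mathcal C\text{ satisfies }\mathcal P]=0$.) -/

import Mathlib

open MeasureTheory ProbabilityTheory

namespace LCL

/-- A code of length `n` over the alphabet `𝔽`: a set of words. -/
abbrev Code (𝔽 : Type*) (n : ℕ) := Set (Fin n → 𝔽)

/-- A property of codes of length `n`: a family of codes.
A code satisfies the property if it belongs to the family. -/
abbrev CodeProperty (𝔽 : Type*) (n : ℕ) := Set (Code 𝔽 n)

/-- A `b`-local profile: a sequence of `n` linear subspaces of `𝔽 ^ b`. -/
abbrev LocalProfile (𝔽 : Type*) [Field 𝔽] (n b : ℕ) := Fin n → Submodule 𝔽 (Fin b → 𝔽)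

section Properties

variable {𝔽 : Type*} [Field 𝔽] {n b : ℕ}

/-- The code `C` contains the matrix `A`: every column of `A` is a word of `C`. -/
def Code.ContainsMatrix (C : Code 𝔽 n) (A : Matrix (Fin n) (Fin b) 𝔽) : Prop :=
  ∀ j : Fin b, (fun i => A i j) ∈ C

/-- The columns of `A` are pairwise distinct. -/
def HasDistinctColumns (A : Matrix (Fin n) (Fin b) 𝔽) : Prop :=
  ∀ j j' : Fin b, j ≠ j' → (fun i => A i j) ≠ (fun i => A i j')

/-- The matrix `A` satisfies the profile `V`: its `i`-th row belongs to `V i`, for every `i`. -/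
def LocalProfile.SatisfiedBy (V : LocalProfile 𝔽 n b) (A : Matrix (Fin n) (Fin b) 𝔽) : Prop :=
  ∀ i : Fin n, A i ∈ V i

/-- The code `C` contains the profile `V`: it contains some matrix with pairwise distinct
columns that satisfies `V`. -/
def Code.ContainsProfile (C : Code 𝔽 n) (V : LocalProfile 𝔽 n b) : Prop :=
  ∃ A : Matrix (Fin n) (Fin b) 𝔽,
    HasDistinctColumns A ∧ V.SatisfiedBy A ∧ Code.ContainsMatrix C A

/-- `P` is a (monotone-increasing) `b`-local coordinate-wise linear property with associated
profile family `F`: it consists of the codes that contain some profile of `F`. -/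
def IsLCLPropertyWith (P : CodeProperty 𝔽 n) (F : Set (LocalProfile 𝔽 n b)) : Prop :=
  P = {C : Code 𝔽 n | ∃ V ∈ F, Code.ContainsProfile C V}

/-- The subspaces `U` of `𝔽 ^ b` such that any two coordinates differ on some vector of `U`. -/
def distinctSubspaces (𝔽 : Type*) [Field 𝔽] (b : ℕ) : Set (Submodule 𝔽 (Fin b → 𝔽)) :=
  {U | ∀ i j : Fin b, i < j → ∃ x ∈ U, x i ≠ x j}

/-- The quantity
`1 - (∑ i, (dim (V i ∩ U) - dim (V i ∩ W))) / (n * (dim U - dim W))`. -/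
noncomputable def rateTerm (V : LocalProfile 𝔽 n b) (U W : Submodule 𝔽 (Fin b → 𝔽)) : ℝ :=
  1 - (∑ i : Fin n, ((Module.finrank 𝔽 (V i ⊓ U : Submodule 𝔽 (Fin b → 𝔽)) : ℝ)
          - (Module.finrank 𝔽 (V i ⊓ W : Submodule 𝔽 (Fin b → 𝔽)) : ℝ)))
      / ((n : ℝ) * ((Module.finrank 𝔽 U : ℝ) - (Module.finrank 𝔽 W : ℝ)))

/-- The threshold rate of random linear codes for `(V, U)`: the maximum of `rateTerm V U W` over
the proper subspaces `W` of `U`. Over a finite field the range is finite, so the supremum is a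
maximum; over the empty range (`U = 0`) it is `-∞`. -/
noncomputable def pairThreshold (V : LocalProfile 𝔽 n b) (U : Submodule 𝔽 (Fin b → 𝔽)) : EReal :=
  ⨆ (W : Submodule 𝔽 (Fin b → 𝔽)) (_ : W < U), (rateTerm V U W : EReal)

/-- The threshold rate of random linear codes for the profile `V`. -/
noncomputable def profileThreshold (V : LocalProfile 𝔽 n b) : EReal :=
  ⨅ U ∈ distinctSubspaces 𝔽 b, pairThreshold V U

/-- The threshold rate of random linear codes for the property with profile family `F`
(`+∞` if `F` is empty). -/
noncomputable def thresholdRate (F : Set (LocalProfile 𝔽 n b)) : EReal :=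
  ⨅ V ∈ F, profileThreshold V

/-- The Reed–Solomon code with evaluation points `α 0, …, α (n - 1)` (repetitions allowed) and
dimension parameter `k`: the evaluation vectors of the polynomials of degree less than `k`. -/
def reedSolomonCode (α : Fin n → 𝔽) (k : ℕ) : Code 𝔽 n :=
  {c | ∃ f : Polynomial 𝔽, f.degree < (k : WithBot ℕ) ∧ c = fun i => f.eval (α i)}

end Properties

end LCL

namespace LCL

open Polynomial

/-! ### Determinants of polynomial vectors: rank at a point and order of vanishing -/

section PolynomialVectors

variable {E : Type*} [Field E] {k d : ℕ}

/-- Evaluation at `γ` of the vector of polynomials with coefficient vectors `f 0, …, f (k - 1)`. -/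
def evalAt (γ : E) : (Fin k → Fin d → E) →ₗ[E] (Fin d → E) :=
  ∑ t : Fin k, γ ^ (t : ℕ) • LinearMap.proj t

lemma evalAt_apply (γ : E) (f : Fin k → Fin d → E) :
    evalAt γ f = ∑ t : Fin k, γ ^ (t : ℕ) • f t := by
  simp [evalAt]

/-- The square matrix of polynomials whose columns are the images under `π` of the vectors of
polynomials `f j`. -/
noncomputable def polyMatrix {r : ℕ} (π : (Fin d → E) →ₗ[E] (Fin r → E))
    (f : Fin r → Fin k → Fin d → E) : Matrix (Fin r) (Fin r) E[X] :=
  Matrix.of fun a j => ∑ t : Fin k, C (π (f j t) a) * X ^ (t : ℕ)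

lemma eval_polyMatrix {r : ℕ} (π : (Fin d → E) →ₗ[E] (Fin r → E))
    (f : Fin r → Fin k → Fin d → E) (γ : E) (a j : Fin r) :
    (polyMatrix π f a j).eval γ = π (evalAt γ (f j)) a := by
  simp only [polyMatrix, Matrix.of_apply, eval_finsetSum, eval_mul, eval_C, eval_pow, eval_X,
    evalAt_apply, map_sum, map_smul, Finset.sum_apply, Pi.smul_apply, smul_eq_mul]
  exact Finset.sum_congr rfl fun t _ => mul_comm _ _

lemma map_eval_polyMatrix {r : ℕ} (π : (Fin d → E) →ₗ[E] (Fin r → E))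
    (f : Fin r → Fin k → Fin d → E) (γ : E) :
    (polyMatrix π f).map (eval γ) = Matrix.of fun a j => π (evalAt γ (f j)) a := by
  ext a j
  simp [eval_polyMatrix]

lemma eval_det_polyMatrix {r : ℕ} (π : (Fin d → E) →ₗ[E] (Fin r → E))
    (f : Fin r → Fin k → Fin d → E) (γ : E) :
    (polyMatrix π f).det.eval γ = (Matrix.of fun a j => π (evalAt γ (f j)) a).det := by
  rw [← map_eval_polyMatrix, ← coe_evalRingHom, RingHom.map_det]
  rfl

lemma natDegree_det_polyMatrix_le {r : ℕ} (π : (Fin d → E) →ₗ[E] (Fin r → E))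
    (f : Fin r → Fin k → Fin d → E) :
    (polyMatrix π f).det.natDegree ≤ r * (k - 1) := by
  have hentry : ∀ a j, (polyMatrix π f a j).natDegree ≤ k - 1 := by
    intro a j
    simp only [polyMatrix, Matrix.of_apply]
    refine natDegree_sum_le_of_forall_le _ _ fun t _ => ?_
    refine (natDegree_C_mul_X_pow_le (π (f j t) a) (t : ℕ)).trans ?_
    have := t.2
    omega
  rw [Matrix.det_apply]
  refine natDegree_sum_le_of_forall_le _ _ fun σ _ => ?_
  refine (natDegree_smul_le _ _).trans ((natDegree_prod_le _ _).trans ?_)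
  refine (Finset.sum_le_sum fun i _ => hentry (σ i) i).trans ?_
  simp

/-- Linearly independent vectors are mapped to the standard basis by some linear map. -/
lemma exists_leftInverse_of_linearIndependent {r : ℕ} {u : Fin r → Fin d → E}
    (hu : LinearIndependent E u) :
    ∃ π : (Fin d → E) →ₗ[E] (Fin r → E), ∀ j, π (u j) = Pi.single j 1 := by
  obtain ⟨π, hπ⟩ := (Fintype.linearCombination E u).exists_leftInverse_of_injective
    (LinearMap.ker_eq_bot.2 (linearIndependent_iff_injective_fintypeLinearCombination.1 hu))
  refine ⟨π, fun j => ?_⟩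
  have := congrArg (fun g => g (Pi.single j 1)) hπ
  simpa [Fintype.linearCombination_apply_single] using this

/-- A finite-dimensional image admits a basis consisting of images. -/
lemma exists_lift_linearIndependent {M N : Type*} [AddCommGroup M] [Module E M] [AddCommGroup N]
    [Module E N] [FiniteDimensional E N] (L : Submodule E M) (T : M →ₗ[E] N) :
    ∃ f : Fin (Module.finrank E (L.map T)) → M,
      (∀ j, f j ∈ L) ∧ LinearIndependent E fun j => T (f j) := by
  let B := Module.finBasis E (L.map T)
  have hB : ∀ j, ∃ x ∈ L, T x = (B j : N) := fun j => (Submodule.mem_map).1 (B j).2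
  choose f hf hTf using hB
  refine ⟨f, hf, ?_⟩
  have := B.linearIndependent.map' (L.map T).subtype (Submodule.ker_subtype _)
  have hcomp : (fun j => T (f j)) = (L.map T).subtype ∘ B := funext fun j => by simp [hTf]
  exact hcomp ▸ this

/-- Rank is lower semicontinuous in the point. Take elements of `L` whose images at `γ₀` form a
basis, and project so that their matrix at `γ₀` is the identity. Its determinant as a polynomial in
the point is `p`, and the images stay independent wherever `p` does not vanish. -/
lemma exists_polynomial_rank_le (L : Submodule E (Fin k → Fin d → E))
    (T : (Fin d → E) →ₗ[E] (Fin d → E)) (γ₀ : E) :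
    ∃ p : E[X], p ≠ 0 ∧ p.natDegree ≤ d * (k - 1) ∧ ∀ γ : E, p.eval γ ≠ 0 →
      Module.finrank E (L.map (T ∘ₗ evalAt γ₀)) ≤ Module.finrank E (L.map (T ∘ₗ evalAt γ)) := by
  set r := Module.finrank E (L.map (T ∘ₗ evalAt γ₀)) with hr
  obtain ⟨f, hfL, hf⟩ := exists_lift_linearIndependent L (T ∘ₗ evalAt γ₀)
  obtain ⟨π, hπ⟩ := exists_leftInverse_of_linearIndependent hf
  have hrd : r ≤ d := by simpa using Submodule.finrank_le (L.map (T ∘ₗ evalAt γ₀))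
  refine ⟨(polyMatrix (π ∘ₗ T) f).det, ?_, ?_, ?_⟩
  · intro h0
    have h1 := eval_det_polyMatrix (π ∘ₗ T) f γ₀
    rw [h0, eval_zero] at h1
    have h2 : (Matrix.of fun a j => (π ∘ₗ T) (evalAt γ₀ (f j)) a) = 1 := by
      ext a j
      have := congrFun (hπ j) a
      simp only [LinearMap.comp_apply] at this
      simp [this, Matrix.one_apply, Pi.single_apply]
    rw [h2, Matrix.det_one] at h1
    exact zero_ne_one h1
  · exact (natDegree_det_polyMatrix_le _ _).trans (Nat.mul_le_mul_right _ hrd)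
  · intro γ hγ
    rw [eval_det_polyMatrix] at hγ
    have h1 : LinearIndependent E fun j => (π ∘ₗ T) (evalAt γ (f j)) :=
      Matrix.linearIndependent_cols_of_det_ne_zero hγ
    have h2 : LinearIndependent E fun j => (T ∘ₗ evalAt γ) (f j) :=
      LinearIndependent.of_comp π h1
    have h3 : LinearIndependent E
        fun j => (⟨(T ∘ₗ evalAt γ) (f j), Submodule.mem_map_of_mem (hfL j)⟩ :
          L.map (T ∘ₗ evalAt γ)) :=
      LinearIndependent.of_comp (L.map (T ∘ₗ evalAt γ)).subtype h2
    simpa using h3.fintype_card_le_finrank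

/-- The determinant of a matrix of polynomials vanishes at `β` at least to the order of the
corank of the value at `β`. -/
lemma pow_corank_dvd_det {r : ℕ} (Q : Matrix (Fin r) (Fin r) E[X]) (β : E) :
    (X - C β) ^ (r - (Q.map (eval β)).rank) ∣ Q.det := by
  set A := Q.map (eval β) with hA
  -- A constant change of basis adapted to the kernel of `A` makes corank-many columns vanish at
  -- `β`; each contributes one factor `X - C β`.
  let K := LinearMap.ker A.mulVecLin
  obtain ⟨K', hK⟩ := K.exists_isCompl
  let B := (Module.finBasis E K).prod (Module.finBasis E K')
  let B' := B.map (K.prodEquivOfIsCompl K' hK)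
  have hcard : Fintype.card (Fin (Module.finrank E K) ⊕ Fin (Module.finrank E K')) = r := by
    rw [← Module.finrank_eq_card_basis B', Module.finrank_fin_fun]
  let e := Fintype.equivFinOfCardEq hcard
  let b := B'.reindex e
  have hker : ∀ j, A.mulVec (b (e (Sum.inl j))) = 0 := by
    intro j
    have : b (e (Sum.inl j)) = (Module.finBasis E K j : Fin r → E) := by
      simp [b, B', B]
    rw [this]
    exact (Module.finBasis E K j).2
  let P : Matrix (Fin r) (Fin r) E := (Pi.basisFun E (Fin r)).toMatrix b
  have hP : IsUnit P.det := by
    rw [← Module.Basis.det_apply]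
    exact (Pi.basisFun E (Fin r)).isUnit_det b
  have hPapp : ∀ a j, P a j = b j a := by
    intro a j; simp [P, Module.Basis.toMatrix_apply]
  let v : Fin r → E[X] := fun j => Sum.elim (fun _ => X - C β) (fun _ => 1) (e.symm j)
  have hdvd : ∀ a j, v j ∣ (Q * P.map C) a j := by
    intro a j
    obtain ⟨s, rfl⟩ := e.surjective j
    cases s with
    | inr s => simp [v]
    | inl s =>
      simp only [v, Equiv.symm_apply_apply, Sum.elim_inl]
      rw [dvd_iff_isRoot, IsRoot.def]
      have := congrFun (hker s) a
      simpa [Matrix.mul_apply, eval_finsetSum, hPapp, Matrix.mulVec, dotProduct, hA] using this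
  choose Q' hQ' using hdvd
  have hdet : (Q * P.map C).det = (∏ j, v j) * (Matrix.of Q').det := by
    rw [← Matrix.det_mul_row]
    congr 1
    ext1 a j
    simp [hQ']
  have hv : ∏ j, v j = (X - C β) ^ (r - A.rank) := by
    rw [← e.prod_comp]
    simp only [v, Equiv.symm_apply_apply, Fintype.prod_sum_type, Sum.elim_inl, Sum.elim_inr]
    have h1 := A.mulVecLin.finrank_range_add_finrank_ker
    rw [Module.finrank_fin_fun] at h1
    have h2 : Module.finrank E K = r - A.rank := by
      rw [Matrix.rank]; simp only [K]; omega
    simp [h2]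
  have hPu : IsUnit (P.map C).det := by
    have : (P.map C).det = C P.det := by
      rw [RingHom.map_det]; rfl
    rw [this]
    exact hP.map C
  rw [Matrix.det_mul, hv] at hdet
  exact (hPu.dvd_mul_right).1 (hdet ▸ dvd_mul_right _ _)

/-- If `r` vectors of polynomials of degree less than `k` from `L` have independent values at some
point, the defects of the spaces of values at distinct points add up to at most `r * (k - 1)`. -/
lemma sum_defect_le {ι : Type*} (L : Submodule E (Fin k → Fin d → E)) (γ : E)
    (S : Finset ι) (β : ι → E) (hβ : Function.Injective β) :
    ∑ i ∈ S, (Module.finrank E (L.map (evalAt γ)) - Module.finrank E (L.map (evalAt (β i)))) ≤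
      Module.finrank E (L.map (evalAt γ)) * (k - 1) := by
  set r := Module.finrank E (L.map (evalAt γ)) with hr
  obtain ⟨f, hfL, hf⟩ := exists_lift_linearIndependent L (evalAt γ)
  obtain ⟨π, hπ⟩ := exists_leftInverse_of_linearIndependent hf
  have hne : (polyMatrix π f).det ≠ 0 := by
    intro h0
    have h1 := eval_det_polyMatrix π f γ
    rw [h0, eval_zero] at h1
    have h2 : (Matrix.of fun a j => π (evalAt γ (f j)) a) = 1 := by
      ext a j
      simp [hπ j, Matrix.one_apply, Pi.single_apply]
    rw [h2, Matrix.det_one] at h1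
    exact zero_ne_one h1
  have hdvd : ∀ i, (X - C (β i)) ^ (r - Module.finrank E (L.map (evalAt (β i)))) ∣
      (polyMatrix π f).det := by
    intro i
    refine (pow_dvd_pow _ (Nat.sub_le_sub_left ?_ r)).trans (pow_corank_dvd_det _ (β i))
    rw [map_eval_polyMatrix, Matrix.rank_eq_finrank_span_cols]
    refine (Submodule.finrank_mono (t := (L.map (evalAt (β i))).map π) ?_).trans
      (Submodule.finrank_map_le _ _)
    rw [Submodule.span_le]
    rintro _ ⟨j, rfl⟩
    exact Submodule.mem_map_of_mem (Submodule.mem_map_of_mem (hfL j))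
  have hprod : ∏ i ∈ S, (X - C (β i)) ^ (r - Module.finrank E (L.map (evalAt (β i)))) ∣
      (polyMatrix π f).det := by
    refine Finset.prod_dvd_of_coprime (fun i _ j _ hij => ?_) fun i _ => hdvd i
    exact (isCoprime_X_sub_C_of_isUnit_sub
      (sub_ne_zero.2 (hβ.ne hij)).isUnit).pow
  have := (natDegree_le_of_dvd hprod hne).trans (natDegree_det_polyMatrix_le π f)
  rw [natDegree_prod _ _ (fun i _ => pow_ne_zero _ (X_sub_C_ne_zero _))] at this
  simpa using this

end PolynomialVectors

section Solutions

variable {E : Type*} [Field E] {k d n : ℕ}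

/-- The coefficient arrays of the vectors of polynomials of degree less than `k` whose value at
`β i` lies in the kernel of `T i`, for every `i ∈ S`. -/
def solutions (k : ℕ) (T : Fin n → (Fin d → E) →ₗ[E] (Fin d → E)) (S : Finset (Fin n))
    (β : Fin n → E) : Submodule E (Fin k → Fin d → E) :=
  ⨅ i ∈ S, LinearMap.ker (T i ∘ₗ evalAt (β i))

variable {T : Fin n → (Fin d → E) →ₗ[E] (Fin d → E)} {S S' : Finset (Fin n)} {β β' : Fin n → E}

lemma mem_solutions {f : Fin k → Fin d → E} :
    f ∈ solutions k T S β ↔ ∀ i ∈ S, T i (evalAt (β i) f) = 0 := by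
  simp [solutions]

lemma solutions_anti (h : S ⊆ S') : solutions k T S' β ≤ solutions k T S β :=
  fun _ hf => mem_solutions.2 fun i hi => mem_solutions.1 hf i (h hi)

lemma solutions_congr (h : ∀ i ∈ S, β i = β' i) : solutions k T S β = solutions k T S β' := by
  ext f
  simp only [mem_solutions]
  exact forall₂_congr fun i hi => by rw [h i hi]

lemma solutions_eq_inf_ker {i : Fin n} (hi : i ∈ S) :
    solutions k T S β = solutions k T (S.erase i) β ⊓ LinearMap.ker (T i ∘ₗ evalAt (β i)) := by
  ext f
  simp only [mem_solutions, Submodule.mem_inf, LinearMap.mem_ker, LinearMap.comp_apply,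
    Finset.mem_erase]
  refine ⟨fun h => ⟨fun j hj => h j hj.2, h i hi⟩, fun h j hj => ?_⟩
  by_cases hji : j = i
  · exact hji ▸ h.2
  · exact h.1 j ⟨hji, hj⟩

lemma finrank_inf_ker_add_finrank_map {M N : Type*} [AddCommGroup M] [Module E M]
    [FiniteDimensional E M] [AddCommGroup N] [Module E N] (L : Submodule E M) (g : M →ₗ[E] N) :
    Module.finrank E (L ⊓ LinearMap.ker g : Submodule E M) + Module.finrank E (L.map g) =
      Module.finrank E L := by
  have h := (g.domRestrict L).finrank_range_add_finrank_ker
  rw [LinearMap.range_domRestrict, LinearMap.ker_domRestrict] at h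
  have h2 : Module.finrank E ((LinearMap.ker g).submoduleOf L) =
      Module.finrank E (L ⊓ LinearMap.ker g : Submodule E M) := by
    rw [← Submodule.finrank_map_subtype_eq, Submodule.submoduleOf, Submodule.map_comap_subtype]
  rw [← h2, add_comm]
  exact h

/-- Over an infinite field there are distinct points, each of which imposes on the solutions for
the other points as many conditions as possible. -/
lemma exists_generic_points [Infinite E] (k : ℕ) (T : Fin n → (Fin d → E) →ₗ[E] (Fin d → E)) :
    ∃ β : Fin n → E, Function.Injective β ∧ ∀ S : Finset (Fin n), ∀ i ∈ S, ∀ γ : E,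
      Module.finrank E ((solutions k T (S.erase i) β).map (T i ∘ₗ evalAt γ)) ≤
        Module.finrank E ((solutions k T (S.erase i) β).map (T i ∘ₗ evalAt (β i))) := by
  classical
  -- Distinct points that minimize the total dimension of all solution spaces work for every `S` at
  -- once.
  let Φ : (Fin n → E) → ℕ := fun β => ∑ S : Finset (Fin n), Module.finrank E (solutions k T S β)
  have hne : {β : Fin n → E | Function.Injective β}.Nonempty :=
    ⟨fun i => Infinite.natEmbedding E i,
      fun i j h => Fin.ext ((Infinite.natEmbedding E).injective h)⟩
  obtain ⟨β, hβ, hmin⟩ := (measure Φ).wf.has_min _ hne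
  refine ⟨β, hβ, fun S₀ i hi₀ γ => ?_⟩
  by_contra! hlt
  -- Outside the roots of these polynomials, a new i-th point attains at least the better rank of
  -- `γ` for `S₀` and loses no rank for the other `S`, so `Φ` strictly drops.
  choose p hp0 _ hp using fun S : Finset (Fin n) =>
    exists_polynomial_rank_le (solutions k T (S.erase i) β) (T i) (if S = S₀ then γ else β i)
  let P : E[X] := (∏ S, p S) * ∏ j, (X - C (β j))
  have hP : P ≠ 0 := mul_ne_zero (Finset.prod_ne_zero_iff.2 fun S _ => hp0 S)
    (Finset.prod_ne_zero_iff.2 fun j _ => X_sub_C_ne_zero _)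
  obtain ⟨γ', hγ'⟩ := Infinite.exists_notMem_finset P.roots.toFinset
  have hev : P.eval γ' ≠ 0 := fun h => hγ' (by simp [hP, h])
  simp only [P, eval_mul, eval_prod, eval_sub, eval_X, eval_C, ne_eq, mul_eq_zero, not_or,
    Finset.prod_eq_zero_iff, not_exists, not_and, Finset.mem_univ, true_implies, sub_eq_zero]
    at hev
  let β' := Function.update β i γ'
  have hβ'inj : Function.Injective β' := by
    intro a c hac
    by_cases ha : a = i <;> by_cases hc : c = i
    · rw [ha, hc]
    · subst ha; simp only [β', Function.update_self, Function.update_of_ne hc] at hac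
      exact absurd hac (hev.2 c)
    · subst hc; simp only [β', Function.update_self, Function.update_of_ne ha] at hac
      exact absurd hac.symm (hev.2 a)
    · simp only [β', Function.update_of_ne ha, Function.update_of_ne hc] at hac
      exact hβ hac
  have herase : ∀ S : Finset (Fin n),
      solutions k T (S.erase i) β' = solutions k T (S.erase i) β := fun S =>
    solutions_congr fun j hj => Function.update_of_ne (Finset.ne_of_mem_erase hj) _ _
  have hdim : ∀ S : Finset (Fin n), i ∈ S →
      Module.finrank E (solutions k T S β') +
        Module.finrank E ((solutions k T (S.erase i) β).map (T i ∘ₗ evalAt γ')) =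
      Module.finrank E (solutions k T S β) +
        Module.finrank E ((solutions k T (S.erase i) β).map (T i ∘ₗ evalAt (β i))) := by
    intro S hS
    have hi : β' i = γ' := Function.update_self _ _ _
    rw [solutions_eq_inf_ker hS (β := β'), solutions_eq_inf_ker hS (β := β), herase, hi,
      finrank_inf_ker_add_finrank_map, finrank_inf_ker_add_finrank_map]
  refine hmin β' hβ'inj (show Φ β' < Φ β from Finset.sum_lt_sum (fun S _ => ?_) ⟨S₀, Finset.mem_univ _, ?_⟩)
  · by_cases hS : i ∈ S
    · have h1 := hdim S hS
      have h2 := hp S γ' (hev.1 S)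
      by_cases hSS : S = S₀
      · rw [if_pos hSS] at h2
        rw [← hSS] at hlt
        omega
      · rw [if_neg hSS] at h2
        omega
    · rw [← Finset.erase_eq_of_notMem hS, herase]
  · have h1 := hdim S₀ hi₀
    have h2 := hp S₀ γ' (hev.1 S₀)
    rw [if_pos rfl] at h2
    omega

/-- The largest dimension of the space of values at a point. -/
noncomputable def genericRank (L : Submodule E (Fin k → Fin d → E)) : ℕ :=
  sSup (Set.range fun γ : E => Module.finrank E (L.map (evalAt γ)))

lemma bddAbove_range_rank (L : Submodule E (Fin k → Fin d → E)) :
    BddAbove (Set.range fun γ : E => Module.finrank E (L.map (evalAt γ))) := by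
  refine ⟨d, ?_⟩
  rintro _ ⟨γ, rfl⟩
  simpa using Submodule.finrank_le (L.map (evalAt γ))

lemma finrank_map_evalAt_le_genericRank (L : Submodule E (Fin k → Fin d → E)) (γ : E) :
    Module.finrank E (L.map (evalAt γ)) ≤ genericRank L :=
  le_csSup (bddAbove_range_rank L) ⟨γ, rfl⟩

lemma exists_finrank_map_evalAt_eq_genericRank (L : Submodule E (Fin k → Fin d → E)) :
    ∃ γ : E, Module.finrank E (L.map (evalAt γ)) = genericRank L :=
  Nat.sSup_mem (Set.range_nonempty _) (bddAbove_range_rank L)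

lemma genericRank_le (L : Submodule E (Fin k → Fin d → E)) : genericRank L ≤ d := by
  obtain ⟨γ, hγ⟩ := exists_finrank_map_evalAt_eq_genericRank L
  rw [← hγ]
  simpa using Submodule.finrank_le (L.map (evalAt γ))

lemma genericRank_mono {L L' : Submodule E (Fin k → Fin d → E)} (h : L ≤ L') :
    genericRank L ≤ genericRank L' := by
  obtain ⟨γ, hγ⟩ := exists_finrank_map_evalAt_eq_genericRank L
  rw [← hγ]
  exact (Submodule.finrank_mono (Submodule.map_mono h)).trans
    (finrank_map_evalAt_le_genericRank L' γ)

/-- Over an infinite field, a polynomial that vanishes at every point has zero coefficients. -/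
lemma eq_bot_of_genericRank_eq_zero [Infinite E] {L : Submodule E (Fin k → Fin d → E)}
    (h : genericRank L = 0) : L = ⊥ := by
  rw [Submodule.eq_bot_iff]
  intro f hf
  have hz : ∀ γ : E, evalAt γ f = 0 := by
    intro γ
    have h0 := finrank_map_evalAt_le_genericRank L γ
    rw [h, Nat.le_zero, Submodule.finrank_eq_zero] at h0
    have := Submodule.mem_map_of_mem (f := evalAt γ) hf
    rwa [h0, Submodule.mem_bot] at this
  ext t a
  let p : E[X] := ∑ s : Fin k, C (f s a) * X ^ (s : ℕ)
  have hp : p = 0 := by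
    refine Polynomial.funext fun γ => ?_
    have := congrFun (hz γ) a
    rw [evalAt_apply] at this
    simp only [Finset.sum_apply, Pi.smul_apply, smul_eq_mul, Pi.zero_apply] at this
    rw [eval_zero, ← this]
    simp only [p, eval_finsetSum, eval_mul, eval_C, eval_pow, eval_X]
    exact Finset.sum_congr rfl fun s _ => mul_comm _ _
  have hc : p.coeff t = f t a := by
    simp [p, coeff_X_pow, Fin.val_inj]
  rw [← hc, hp]
  simp

/-- If the kernels of the maps `T i` meet every subspace in small dimension on average, then for
suitable points there is no nonzero solution. -/
theorem exists_solutions_eq_bot [Infinite E] (T : Fin n → (Fin d → E) →ₗ[E] (Fin d → E)) (c : ℝ)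
    (hT : ∀ W : Submodule E (Fin d → E),
      ∑ i, (Module.finrank E (LinearMap.ker (T i) ⊓ W : Submodule E (Fin d → E)) : ℝ) ≤
        c * Module.finrank E W)
    (S₀ : Finset (Fin n)) (hS₀ : c + k + d ≤ S₀.card) :
    ∃ β : Fin n → E, solutions k T S₀ β = ⊥ := by
  obtain ⟨β, hβ, hgen⟩ := exists_generic_points k T
  refine ⟨β, ?_⟩
  by_contra hne
  let rk : Finset (Fin n) → ℕ := fun S => genericRank (solutions k T S β)
  have hr₀ : 1 ≤ rk S₀ := Nat.one_le_iff_ne_zero.2 fun h => hne (eq_bot_of_genericRank_eq_zero h)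
  -- A smallest such `S` cannot gain rank when one coordinate is erased: a gain would pay for the
  -- lost element. As ranks are at most `d`, `S` is smaller than `S₀` by at most `d - 1`.
  have hnonempty : {S : Finset (Fin n) | S ⊆ S₀ ∧ S₀.card + rk S₀ ≤ S.card + rk S}.Nonempty :=
    ⟨S₀, Finset.Subset.refl _, le_rfl⟩
  obtain ⟨S, ⟨hSS₀, hScard⟩, hmin⟩ :=
    (measure (Finset.card : Finset (Fin n) → ℕ)).wf.has_min _ hnonempty
  have hrk : ∀ i ∈ S, rk (S.erase i) ≤ rk S := by
    intro i hi
    by_contra! hlt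
    have hcard := Finset.card_erase_add_one hi
    refine hmin (S.erase i) ⟨(Finset.erase_subset _ _).trans hSS₀, by omega⟩ ?_
    change (S.erase i).card < S.card
    omega
  have hrS : rk S₀ ≤ rk S := genericRank_mono (solutions_anti hSS₀)
  obtain ⟨γ, hγ⟩ := exists_finrank_map_evalAt_eq_genericRank (solutions k T S β)
  set W := (solutions k T S β).map (evalAt γ) with hW
  -- With `L` the solutions for `S.erase i`, the values at `β i` lie in L(β i) ∩ ker (T i). Here dim
  -- L(β i) ≤ `rk S` = dim `W`, and genericity gives rank of `T i` on L(β i) ≥ rank on L(γ) ≥ rank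
  -- on `W`. Subtract.
  have hval : ∀ i ∈ S, Module.finrank E ((solutions k T S β).map (evalAt (β i))) ≤
      Module.finrank E (LinearMap.ker (T i) ⊓ W : Submodule E (Fin d → E)) := by
    intro i hi
    set L := solutions k T (S.erase i) β with hL
    have h1 : (solutions k T S β).map (evalAt (β i)) ≤
        L.map (evalAt (β i)) ⊓ LinearMap.ker (T i) := by
      rintro _ ⟨f, hf, rfl⟩
      exact ⟨Submodule.mem_map_of_mem (solutions_anti (Finset.erase_subset _ _) hf),
        mem_solutions.1 hf i hi⟩
    have h2 := finrank_inf_ker_add_finrank_map (L.map (evalAt (β i))) (T i)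
    have h3 := finrank_map_evalAt_le_genericRank L (β i)
    have h4 := hrk i hi
    have h5 := hgen S i hi γ
    have h6 : Module.finrank E (W.map (T i)) ≤
        Module.finrank E (L.map (T i ∘ₗ evalAt γ)) := by
      rw [Submodule.map_comp]
      exact Submodule.finrank_mono (Submodule.map_mono (Submodule.map_mono
        (solutions_anti (Finset.erase_subset _ _))))
    have h7 := finrank_inf_ker_add_finrank_map W (T i)
    rw [← hL, Submodule.map_comp (evalAt (β i)) (T i)] at h5
    rw [inf_comm]
    have h8 := Submodule.finrank_mono h1
    simp only [rk, ← hL] at h4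
    omega
  have hsum := sum_defect_le (solutions k T S β) γ S β hβ
  rw [← hW, hγ] at hsum
  have hsum' : ∑ i ∈ S, (((rk S : ℕ) : ℝ) -
      Module.finrank E (LinearMap.ker (T i) ⊓ W : Submodule E (Fin d → E))) ≤ rk S * k := by
    have h1 : ((∑ i ∈ S, (rk S - Module.finrank E
        ((solutions k T S β).map (evalAt (β i)))) : ℕ) : ℝ) ≤ ((rk S * k : ℕ) : ℝ) :=
      Nat.cast_le.2 (hsum.trans (Nat.mul_le_mul_left _ (Nat.sub_le _ _)))
    push_cast at h1
    refine le_trans (Finset.sum_le_sum fun i hi => ?_) h1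
    have h2 : (Module.finrank E ((solutions k T S β).map (evalAt (β i))) : ℝ) ≤
        Module.finrank E (LinearMap.ker (T i) ⊓ W : Submodule E (Fin d → E)) :=
      Nat.cast_le.2 (hval i hi)
    have h3 := le_tsub_add (a := Module.finrank E ((solutions k T S β).map (evalAt (β i))))
      (b := rk S)
    have h4 : ((rk S : ℕ) : ℝ) ≤
      ((rk S - Module.finrank E ((solutions k T S β).map (evalAt (β i))) : ℕ) : ℝ) +
        Module.finrank E ((solutions k T S β).map (evalAt (β i))) := by exact_mod_cast h3
    linarith
  rw [Finset.sum_sub_distrib, Finset.sum_const, nsmul_eq_mul] at hsum'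
  have hle : ∑ i ∈ S, (Module.finrank E (LinearMap.ker (T i) ⊓ W : Submodule E (Fin d → E)) : ℝ) ≤
      c * rk S := by
    refine le_trans (Finset.sum_le_univ_sum_of_nonneg fun i => Nat.cast_nonneg _) ?_
    have := hT W
    rwa [hγ] at this
  have hrpos : (0 : ℝ) < rk S := by exact_mod_cast hr₀.trans hrS
  have hd : rk S ≤ d := genericRank_le _
  -- This forces |S| ≥ c + k + 1, whereas `hsum'` and `hle`, divided by `rk S`, give |S| ≤ c + k.
  have hc : (S₀.card : ℝ) + 1 ≤ S.card + d := by exact_mod_cast (by omega)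
  nlinarith

end Solutions

/-! ### Specialization at 0 of subspaces over the rational functions -/

section Specialization

variable {F K : Type*} [Field F] [Field K] [Algebra F[X] K] {d n : ℕ}

variable (K) in
/-- The entrywise inclusion of vectors of polynomials into vectors of rational functions. -/
noncomputable def polyInclusion (d : ℕ) : (Fin d → F[X]) →ₗ[F[X]] (Fin d → K) :=
  (Algebra.linearMap F[X] K).compLeft (Fin d)

lemma polyInclusion_apply (w : Fin d → F[X]) (i : Fin d) :
    polyInclusion K d w i = algebraMap F[X] K (w i) := rfl

/-- The vectors of polynomials in a space of vectors of rational functions. -/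
noncomputable def integralPart (W : Submodule K (Fin d → K)) : Submodule F[X] (Fin d → F[X]) :=
  (W.restrictScalars F[X]).comap (polyInclusion K d)

lemma mem_integralPart {W : Submodule K (Fin d → K)} {w : Fin d → F[X]} :
    w ∈ integralPart W ↔ polyInclusion K d w ∈ W := Iff.rfl

/-- Entrywise evaluation at `0`. -/
noncomputable def evalZero (F : Type*) [Field F] (d : ℕ) : (Fin d → F[X]) →ₗ[F] (Fin d → F) :=
  (leval 0).compLeft (Fin d)

lemma evalZero_apply (w : Fin d → F[X]) (i : Fin d) : evalZero F d w i = (w i).eval 0 := rfl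

lemma evalZero_smul (p : F[X]) (w : Fin d → F[X]) :
    evalZero F d (p • w) = p.eval 0 • evalZero F d w := by
  ext i
  simp [evalZero_apply]

/-- The specialization at `0` of a space of vectors of rational functions. -/
noncomputable def specialization (W : Submodule K (Fin d → K)) : Submodule F (Fin d → F) :=
  ((integralPart W).restrictScalars F).map (evalZero F d)

variable [IsFractionRing F[X] K]

lemma polyInclusion_injective : Function.Injective (polyInclusion (F := F) K d) := fun _ _ h =>
  funext fun i => IsFractionRing.injective F[X] K (congrFun h i)

/-- The polynomial vectors in `W` form a free module, whose basis is a `K`-basis of `W` after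
clearing denominators. It stays independent at 0 because this module is saturated: if `X • w`
belongs to it, so does `w`. -/
lemma finrank_specialization (W : Submodule K (Fin d → K)) :
    Module.finrank F (specialization (F := F) W) = Module.finrank K W := by
  obtain ⟨m, B⟩ := Submodule.basisOfPid (Pi.basisFun F[X] (Fin d)) (integralPart W)
  let v : Fin m → Fin d → F[X] := fun j => B j
  have hvmem : ∀ j, v j ∈ integralPart W := fun j => (B j).2
  have hv : LinearIndependent F[X] v :=
    B.linearIndependent.map' (integralPart W).subtype (Submodule.ker_subtype _)
  have hspan : ∀ w ∈ integralPart (F := F) W, ∃ c : Fin m → F[X], w = ∑ j, c j • v j := by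
    intro w hw
    refine ⟨B.repr ⟨w, hw⟩, ?_⟩
    have := congrArg Subtype.val (B.sum_repr ⟨w, hw⟩)
    rw [AddSubmonoidClass.coe_finsetSum] at this
    exact this.symm
  have hK : Module.finrank K W = m := by
    have hli : LinearIndependent K fun j => polyInclusion K d (v j) := by
      rw [← LinearIndependent.iff_fractionRing F[X] K]
      exact hv.map' _ (LinearMap.ker_eq_bot.2 polyInclusion_injective)
    have hW : Submodule.span K (Set.range fun j => polyInclusion K d (v j)) = W := by
      refine le_antisymm (Submodule.span_le.2 ?_) fun x hx => ?_
      · rintro _ ⟨j, rfl⟩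
        exact hvmem j
      · obtain ⟨a, ha⟩ := IsLocalization.exist_integer_multiples_of_finite
          (nonZeroDivisors F[X]) x
        choose w hw using ha
        have ha0 : algebraMap F[X] K a ≠ 0 :=
          IsFractionRing.to_map_ne_zero_of_mem_nonZeroDivisors a.2
        have hwx : polyInclusion K d w = algebraMap F[X] K a • x := by
          ext i
          rw [polyInclusion_apply, hw i, Pi.smul_apply, smul_eq_mul]
          exact Algebra.smul_def _ _
        obtain ⟨c, hc⟩ := hspan w (by
          rw [mem_integralPart, hwx]; exact W.smul_mem _ hx)
        have hx' : x = (algebraMap F[X] K a)⁻¹ • polyInclusion K d w := by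
          rw [hwx, smul_smul, inv_mul_cancel₀ ha0, one_smul]
        rw [hx', hc, map_sum]
        refine Submodule.smul_mem _ _ (Submodule.sum_mem _ fun j _ => ?_)
        rw [map_smul, ← algebraMap_smul K (c j)]
        exact Submodule.smul_mem _ _ (Submodule.subset_span ⟨j, rfl⟩)
    rw [← hW, finrank_span_eq_card hli, Fintype.card_fin]
  have hF : Module.finrank F (specialization (F := F) W) = m := by
    have hli : LinearIndependent F fun j => evalZero F d (v j) := by
      rw [Fintype.linearIndependent_iff]
      intro c hc
      have hdvd : ∀ i, X ∣ (∑ j, C (c j) • v j) i := by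
        intro i
        rw [X_dvd_iff, coeff_zero_eq_eval_zero, ← evalZero_apply, map_sum]
        simp only [evalZero_smul, eval_C, hc, Pi.zero_apply]
      choose w hw using hdvd
      have hw' : ∑ j, C (c j) • v j = (X : F[X]) • w := by
        ext1 i
        rw [hw i]; rfl
      have hwm : w ∈ integralPart W := by
        have hmem : polyInclusion K d ((X : F[X]) • w) ∈ W := by
          rw [← mem_integralPart, ← hw']
          exact Submodule.sum_mem _ fun j _ => Submodule.smul_mem _ _ (hvmem j)
        rw [map_smul, ← algebraMap_smul K (X : F[X])] at hmem
        have hX : algebraMap F[X] K X ≠ 0 := by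
          rw [Ne, IsFractionRing.to_map_eq_zero_iff]
          exact X_ne_zero
        exact (W.smul_mem_iff hX).1 hmem
      obtain ⟨a, ha⟩ := hspan w hwm
      -- Independence of `v` gives c j = X · a j with c j constant; evaluation at 0 yields c j = 0.
      rw [ha, Finset.smul_sum, ← sub_eq_zero, ← Finset.sum_sub_distrib] at hw'
      simp only [smul_smul, ← sub_smul] at hw'
      intro j
      have hj := Fintype.linearIndependent_iff.1 hv _ hw' j
      have := congrArg (eval 0) hj
      simpa using this
    have hsp : Submodule.span F (Set.range fun j => evalZero F d (v j)) = specialization W := by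
      refine le_antisymm (Submodule.span_le.2 ?_) ?_
      · rintro _ ⟨j, rfl⟩
        exact Submodule.mem_map_of_mem (hvmem j)
      · rintro _ ⟨w, hw, rfl⟩
        obtain ⟨c, hc⟩ := hspan w hw
        rw [hc, map_sum]
        refine Submodule.sum_mem _ fun j _ => ?_
        rw [evalZero_smul]
        exact Submodule.smul_mem _ _ (Submodule.subset_span ⟨j, rfl⟩)
    rw [← hsp, finrank_span_eq_card hli, Fintype.card_fin]
  rw [hK, hF]

variable [Algebra F K] [IsScalarTower F F[X] K]

/-- The entries of `H` are constants, so applying `H` commutes with evaluation at 0. -/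
lemma specialization_ker_inf_le (H : Matrix (Fin d) (Fin d) F) (W : Submodule K (Fin d → K)) :
    specialization (LinearMap.ker (H.map (algebraMap F K)).mulVecLin ⊓ W) ≤
      LinearMap.ker H.mulVecLin ⊓ specialization W := by
  rintro _ ⟨w, hw, rfl⟩
  refine ⟨?_, Submodule.mem_map_of_mem hw.2⟩
  have h1 : ∀ a, ∑ j, C (H a j) * w j = 0 := by
    intro a
    have h := congrFun (LinearMap.mem_ker.1 hw.1) a
    refine IsFractionRing.injective F[X] K ?_
    rw [map_zero, map_sum]
    simpa [Matrix.mulVec, dotProduct, polyInclusion_apply,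
      IsScalarTower.algebraMap_apply F F[X] K] using h
  refine LinearMap.mem_ker.2 (funext fun a => ?_)
  have := congrArg (eval 0) (h1 a)
  simpa [eval_finsetSum, Matrix.mulVec, dotProduct, evalZero_apply] using this

/-- A bound for the dimensions of the intersections of kernels with subspaces carries over to the
field of rational functions. -/
lemma sum_finrank_ker_inf_le_of_fractionRing (H : Fin n → Matrix (Fin d) (Fin d) F) (c : ℝ)
    (hH : ∀ W : Submodule F (Fin d → F),
      ∑ i, (Module.finrank F
        (LinearMap.ker (H i).mulVecLin ⊓ W : Submodule F (Fin d → F)) : ℝ) ≤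
          c * Module.finrank F W)
    (W : Submodule K (Fin d → K)) :
    ∑ i, (Module.finrank K (LinearMap.ker ((H i).map (algebraMap F K)).mulVecLin ⊓ W :
      Submodule K (Fin d → K)) : ℝ) ≤ c * Module.finrank K W := by
  rw [← finrank_specialization (F := F) W]
  refine le_trans (Finset.sum_le_sum fun i _ => ?_) (hH _)
  rw [← finrank_specialization (F := F), Nat.cast_le]
  exact Submodule.finrank_mono (specialization_ker_inf_le (H i) W)

end Specialization

/-! ### Certificates for bad evaluation points, and their number -/

section Certificates

variable {F K : Type*} [Field F] [Field K] [Algebra F K] {k d n : ℕ}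

/-- The points `α` below `m`, followed by the points `β`. -/
def splice (α : Fin n → F) (β : Fin n → K) (m : ℕ) : Fin n → K :=
  fun l => if (l : ℕ) < m then algebraMap F K (α l) else β l

/-- The first `m` of the points `α` can be completed, over the larger field, to points for which
there is no nonzero solution. -/
def IsExtendable (k : ℕ) (T : Fin n → (Fin d → K) →ₗ[K] (Fin d → K)) (S : Finset (Fin n))
    (α : Fin n → F) (m : ℕ) : Prop :=
  ∃ β : Fin n → K, solutions k T S (splice α β m) = ⊥

variable {T : Fin n → (Fin d → K) →ₗ[K] (Fin d → K)} {S : Finset (Fin n)} {α α' : Fin n → F}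

lemma splice_congr {m : ℕ} (h : ∀ l : Fin n, (l : ℕ) < m → α l = α' l) (β : Fin n → K) :
    splice α β m = splice α' β m := by
  ext l
  unfold splice
  split_ifs with hl
  · rw [h l hl]
  · rfl

lemma isExtendable_congr {m : ℕ} (h : ∀ l : Fin n, (l : ℕ) < m → α l = α' l) :
    IsExtendable k T S α m ↔ IsExtendable k T S α' m := by
  simp only [IsExtendable, splice_congr h]

lemma splice_update_succ_of_ne {i l : Fin n} (h : l ≠ i) (γ : F) (β : Fin n → K) :
    splice (Function.update α i γ) β (i + 1) l = splice α β i l := by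
  have h' : (l : ℕ) ≠ i := fun h' => h (Fin.ext h')
  unfold splice
  rw [Function.update_of_ne h]
  exact if_congr (by omega) rfl rfl

lemma splice_update_succ_self (i : Fin n) (γ : F) (β : Fin n → K) :
    splice (Function.update α i γ) β (i + 1) i = algebraMap F K γ := by
  simp [splice]

/-- A completion `β` makes `T i ∘ₗ evalAt (β i)` injective on the solutions for the other
coordinates. Full rank persists outside the roots of one nonzero polynomial, and with it the same
`β` still completes the points. -/
lemma card_not_isExtendable_le {i : Fin n} (hi : i ∈ S)
    (h : IsExtendable k T S α i) (B : Finset F)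
    (hB : ∀ γ ∈ B, ¬ IsExtendable k T S (Function.update α i γ) (i + 1)) :
    B.card ≤ d * (k - 1) := by
  classical
  obtain ⟨β, hβ⟩ := h
  set L := solutions k T (S.erase i) (splice α β i) with hL
  have hβi : splice α β (i : ℕ) i = β i := by simp [splice]
  have hrank : Module.finrank K (L.map (T i ∘ₗ evalAt (β i))) = Module.finrank K L := by
    rw [solutions_eq_inf_ker hi, ← hL, hβi] at hβ
    have := finrank_inf_ker_add_finrank_map L (T i ∘ₗ evalAt (β i))
    rw [hβ, finrank_bot] at this
    omega
  obtain ⟨p, hp0, hpdeg, hp⟩ := exists_polynomial_rank_le L (T i) (β i)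
  have hroot : ∀ γ ∈ B, algebraMap F K γ ∈ p.roots.toFinset := by
    intro γ hγ
    rw [Multiset.mem_toFinset, mem_roots hp0, IsRoot.def]
    by_contra hne
    refine hB γ hγ ⟨β, ?_⟩
    have h1 := hp _ hne
    have h2 := finrank_inf_ker_add_finrank_map L (T i ∘ₗ evalAt (algebraMap F K γ))
    have hL' : solutions k T (S.erase i) (splice (Function.update α i γ) β (i + 1)) = L :=
      solutions_congr fun l hl => splice_update_succ_of_ne (Finset.ne_of_mem_erase hl) γ β
    rw [solutions_eq_inf_ker hi, hL', splice_update_succ_self, ← Submodule.finrank_eq_zero (R := K)]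
    omega
  calc B.card = (B.image (algebraMap F K)).card :=
        (Finset.card_image_of_injective _ (algebraMap F K).injective).symm
    _ ≤ p.roots.toFinset.card := Finset.card_le_card (Finset.image_subset_iff.2 hroot)
    _ ≤ Multiset.card p.roots := Multiset.toFinset_card_le _
    _ ≤ d * (k - 1) := (p.card_roots').trans hpdeg

/-- A choice of points with a nonzero solution has a certificate: a set `D` of `τ` coordinates such
that for every `i ∈ D`, without the later coordinates of `D`, the points before `i` can be completed
to points without nonzero solutions, but the points up to `i` cannot. -/
lemma exists_certificate (τ : ℕ)
    (hT : ∀ D : Finset (Fin n), D.card < τ → ∃ β : Fin n → K, solutions k T Dᶜ β = ⊥)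
    (hα : solutions k T Finset.univ (fun i => algebraMap F K (α i)) ≠ ⊥) :
    ∃ D : Finset (Fin n), D.card = τ ∧ ∀ i ∈ D,
      IsExtendable k T (D.filter (i < ·))ᶜ α i ∧
        ¬ IsExtendable k T (D.filter (i < ·))ᶜ α (i + 1) := by
  classical
  suffices h : ∀ s ≤ τ, ∃ D : Finset (Fin n), ∃ m : ℕ, m ≤ n ∧ D.card = s ∧ (∀ i ∈ D, m ≤ i) ∧
      ¬ IsExtendable k T Dᶜ α m ∧ ∀ i ∈ D,
        IsExtendable k T (D.filter (i < ·))ᶜ α i ∧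
          ¬ IsExtendable k T (D.filter (i < ·))ᶜ α (i + 1) by
    obtain ⟨D, m, -, hD, -, -, h⟩ := h τ le_rfl
    exact ⟨D, hD, h⟩
  -- `D` is found from its largest element downwards: everything in `D` is at least `m`, and the
  -- points before `m` already cannot be completed when the conditions in `D` are dropped.
  intro s
  induction s with
  | zero =>
    refine fun _ => ⟨∅, n, le_rfl, rfl, by simp, ?_, by simp⟩
    rintro ⟨β, hβ⟩
    refine hα ?_
    rw [← hβ, Finset.compl_empty]
    exact solutions_congr fun i _ => by simp [splice]
  | succ s ih =>
    intro hs
    obtain ⟨D, m, hmn, hD, hm, hnot, hcert⟩ := ih (by omega)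
    have hex : ∃ j, ¬ IsExtendable k T Dᶜ α j := ⟨m, hnot⟩
    have h0 : IsExtendable k T Dᶜ α 0 := by
      obtain ⟨β, hβ⟩ := hT D (by omega)
      exact ⟨β, by rw [← hβ]; exact solutions_congr fun i _ => by simp [splice]⟩
    obtain ⟨j, hj⟩ : ∃ j, Nat.find hex = j + 1 :=
      Nat.exists_eq_succ_of_ne_zero fun h => (h ▸ Nat.find_spec hex) h0
    have hjm : j + 1 ≤ m := hj ▸ Nat.find_min' hex hnot
    have hgood : IsExtendable k T Dᶜ α j := not_not.1 (Nat.find_min hex (by omega))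
    have hbad : ¬ IsExtendable k T Dᶜ α (j + 1) := hj ▸ Nat.find_spec hex
    let i : Fin n := ⟨j, by omega⟩
    have hlt : ∀ l ∈ D, i < l := fun l hl => Fin.lt_def.2 (by
      have := hm l hl
      change j < (l : ℕ)
      omega)
    have hiD : i ∉ D := fun h => lt_irrefl _ (hlt i h)
    have hfi : (insert i D).filter (i < ·) = D := by
      rw [Finset.filter_insert, if_neg (lt_irrefl _), Finset.filter_true_of_mem hlt]
    refine ⟨insert i D, j, by omega, by rw [Finset.card_insert_of_notMem hiD, hD], ?_, ?_, ?_⟩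
    · intro l hl
      rcases Finset.mem_insert.1 hl with rfl | hl
      · exact le_rfl
      · exact (Fin.lt_def.1 (hlt l hl)).le
    -- The points spliced at `j` and at `j + 1` differ only at `i`, whose condition is now dropped.
    -- A completion from `j` would thus also complete from `j + 1` for the larger set of conditions.
    · rintro ⟨β, hβ⟩
      refine hbad ⟨β, eq_bot_iff.2 ?_⟩
      rw [← hβ]
      refine (solutions_anti (S := (insert i D)ᶜ)
        (Finset.compl_subset_compl.2 (Finset.subset_insert _ _))).trans_eq ?_
      refine solutions_congr fun l hl => ?_
      have hli : l ≠ i := by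
        rintro rfl
        simp at hl
      have := splice_update_succ_of_ne (α := α) hli (α i) β
      rwa [Function.update_eq_self] at this
    · intro l hl
      rcases Finset.mem_insert.1 hl with rfl | hl
      · rw [hfi]
        exact ⟨hgood, hbad⟩
      · rw [Finset.filter_insert, if_neg (hlt l hl).le.not_gt]
        exact hcert l hl

/-- If each coordinate is confined to a set of at most `N i` values depending on the previous
coordinates only, there are at most `∏ i, N i` choices. -/
lemma card_filter_forall_mem_le {A : Type*} [Fintype A] [DecidableEq A] [Inhabited A] :
    ∀ {n : ℕ} (C : Fin n → (Fin n → A) → Finset A) (N : Fin n → ℕ)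
      (_ : ∀ i a a', (∀ l < i, a l = a' l) → C i a = C i a') (_ : ∀ i a, (C i a).card ≤ N i),
      (Finset.univ.filter fun a : Fin n → A => ∀ i, a i ∈ C i a).card ≤ ∏ i, N i := by
  intro n
  induction n with
  | zero =>
    intro C N _ _
    simp
  | succ n ih =>
    intro C N hC hN
    -- The padding value `default` is harmless, since each constraint depends on earlier coordinates
    -- only.
    let C' : Fin n → (Fin n → A) → Finset A :=
      fun i a => C i.castSucc (Fin.snoc (α := fun _ => A) a default)
    let A' := Finset.univ.filter fun a : Fin n → A => ∀ i, a i ∈ C' i a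
    let G : (Fin n → A) → Finset A :=
      fun a => C (Fin.last n) (Fin.snoc (α := fun _ => A) a default)
    have hsnoc : ∀ (a : Fin (n + 1) → A) (l : Fin n),
        Fin.snoc (α := fun _ => A) (Fin.init a) default l.castSucc = a l.castSucc := by
      intro a l
      simp [Fin.init]
    have hA' : A'.card ≤ ∏ i : Fin n, N i.castSucc := by
      refine ih C' _ (fun i a a' h => hC _ _ _ fun l hl => ?_) fun i a => hN _ _
      obtain ⟨l, rfl⟩ := Fin.exists_castSucc_eq.2 (Fin.ne_last_of_lt hl)
      rw [Fin.snoc_castSucc, Fin.snoc_castSucc]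
      exact h l (Fin.castSucc_lt_castSucc_iff.1 hl)
    have hmaps : (Finset.univ.filter fun a : Fin (n + 1) → A => ∀ i, a i ∈ C i a).card ≤
        (A'.sigma G).card := by
      refine Finset.card_le_card_of_injOn (fun a => ⟨Fin.init a, a (Fin.last n)⟩) ?_ ?_
      · intro a ha
        have ha' : ∀ i, a i ∈ C i a := by simpa using ha
        simp only [Finset.coe_sigma, Set.mem_sigma_iff, Finset.mem_coe]
        constructor
        · refine Finset.mem_filter.2 ⟨Finset.mem_univ _, fun i => ?_⟩
          have h := ha' i.castSucc
          rwa [hC i.castSucc a (Fin.snoc (α := fun _ => A) (Fin.init a) default)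
            fun l hl => by
              obtain ⟨l, rfl⟩ := Fin.exists_castSucc_eq.2 (Fin.ne_last_of_lt hl)
              exact (hsnoc a l).symm] at h
        · have h := ha' (Fin.last n)
          rwa [hC (Fin.last n) a (Fin.snoc (α := fun _ => A) (Fin.init a) default)
            fun l hl => by
              obtain ⟨l, rfl⟩ := Fin.exists_castSucc_eq.2 (Fin.ne_last_of_lt hl)
              exact (hsnoc a l).symm] at h
      · intro a _ a' _ h
        simp only [Sigma.mk.injEq, heq_eq_eq] at h
        rw [← Fin.snoc_init_self a, ← Fin.snoc_init_self a', h.1, h.2]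
    refine hmaps.trans ?_
    rw [Finset.card_sigma, Fin.prod_univ_castSucc]
    refine (Finset.sum_le_card_nsmul _ _ (N (Fin.last n)) fun a _ => hN _ _).trans ?_
    rw [smul_eq_mul]
    exact Nat.mul_le_mul_right _ hA'

/-- The number of choices of points with a nonzero solution. -/
lemma card_solutions_ne_bot_le [Fintype F] [DecidableEq F] (τ : ℕ)
    (hT : ∀ D : Finset (Fin n), D.card < τ → ∃ β : Fin n → K, solutions k T Dᶜ β = ⊥)
    (B : Finset (Fin n → F))
    (hB : ∀ α ∈ B, solutions k T Finset.univ (fun i => algebraMap F K (α i)) ≠ ⊥) :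
    B.card ≤ n.choose τ * ((d * (k - 1)) ^ τ * Fintype.card F ^ (n - τ)) := by
  classical
  -- Replacing the i-th coordinate by `γ` makes this set depend only on the coordinates of `a`
  -- before `i`; it is empty when these cannot be completed.
  let C : Finset (Fin n) → Fin n → (Fin n → F) → Finset F := fun D i a =>
    if i ∈ D then Finset.univ.filter fun γ =>
      IsExtendable k T (D.filter (i < ·))ᶜ a i ∧
        ¬ IsExtendable k T (D.filter (i < ·))ᶜ (Function.update a i γ) (i + 1)
    else Finset.univ
  have hcard : ∀ D ∈ Finset.powersetCard τ (Finset.univ : Finset (Fin n)),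
      (Finset.univ.filter fun a : Fin n → F => ∀ i, a i ∈ C D i a).card ≤
        (d * (k - 1)) ^ τ * Fintype.card F ^ (n - τ) := by
    intro D hD
    have hDτ : D.card = τ := (Finset.mem_powersetCard.1 hD).2
    let N : Fin n → ℕ := fun i => if i ∈ D then d * (k - 1) else Fintype.card F
    have hN : ∏ i, N i = (d * (k - 1)) ^ τ * Fintype.card F ^ (n - τ) := by
      simp only [N, Finset.prod_ite, Finset.prod_const]
      rw [Finset.filter_mem_eq_inter, Finset.univ_inter, ← Finset.compl_filter,
        Finset.filter_mem_eq_inter, Finset.univ_inter, Finset.card_compl, hDτ, Fintype.card_fin]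
    rw [← hN]
    have : Inhabited F := ⟨0⟩
    refine card_filter_forall_mem_le (C D) N (fun i a a' h => ?_) fun i a => ?_
    · simp only [C]
      split_ifs with hi
      · ext γ
        simp only [Finset.mem_filter, Finset.mem_univ, true_and]
        refine and_congr (isExtendable_congr h) (not_congr (isExtendable_congr fun l hl => ?_))
        by_cases hli : l = i
        · simp [hli]
        · rw [Function.update_of_ne hli, Function.update_of_ne hli]
          refine h l (lt_of_le_of_ne (Fin.le_def.2 (by omega)) hli)
      · rfl
    · simp only [C, N]
      split_ifs with hi
      · by_cases hex : IsExtendable k T (D.filter (i < ·))ᶜ a i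
        · refine card_not_isExtendable_le (by simp) hex _ fun γ hγ => (Finset.mem_filter.1 hγ).2.2
        · simp [hex]
      · exact le_rfl
  have hsub : B ⊆ (Finset.powersetCard τ (Finset.univ : Finset (Fin n))).biUnion fun D =>
      Finset.univ.filter fun a : Fin n → F => ∀ i, a i ∈ C D i a := by
    intro a ha
    obtain ⟨D, hD, hcert⟩ := exists_certificate τ hT (hB a ha)
    refine Finset.mem_biUnion.2 ⟨D, Finset.mem_powersetCard.2 ⟨Finset.subset_univ _, hD⟩,
      Finset.mem_filter.2 ⟨Finset.mem_univ _, fun i => ?_⟩⟩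
    simp only [C]
    split_ifs with hi
    · refine Finset.mem_filter.2 ⟨Finset.mem_univ _, ?_⟩
      rw [Function.update_eq_self]
      exact hcert i hi
    · exact Finset.mem_univ _
  refine (Finset.card_le_card hsub).trans (Finset.card_biUnion_le.trans ?_)
  refine (Finset.sum_le_card_nsmul _ _ _ hcard).trans ?_
  rw [Finset.card_powersetCard, Finset.card_univ, Fintype.card_fin, smul_eq_mul]

end Certificates

/-! ### Counting over the finite field -/

section Counting

variable {F : Type*} [Field F] {k d n : ℕ}

lemma exists_matrix_ker_eq (V : Submodule F (Fin d → F)) :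
    ∃ H : Matrix (Fin d) (Fin d) F, LinearMap.ker H.mulVecLin = V := by
  obtain ⟨V', hV⟩ := V.exists_isCompl
  let g : (Fin d → F) →ₗ[F] (Fin d → F) := V'.subtype ∘ₗ V'.projectionOnto V hV.symm
  refine ⟨LinearMap.toMatrix' g, ?_⟩
  have hg : (LinearMap.toMatrix' g).mulVecLin = g := Matrix.toLin'_toMatrix' g
  rw [hg, LinearMap.ker_comp, Submodule.ker_subtype, Submodule.comap_bot]
  simp

/-- If the spaces `V i` meet every subspace in small dimension on average, there are few choices of
points `α` for which some nonzero vector of polynomials of degree less than `k` has its value at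
`α i` in `V i` for all `i`. -/
theorem card_exists_ne_zero_le [Fintype F] [DecidableEq F] (V : LocalProfile F n d) (c : ℝ)
    (hV : ∀ W : Submodule F (Fin d → F),
      ∑ i, (Module.finrank F (V i ⊓ W : Submodule F (Fin d → F)) : ℝ) ≤ c * Module.finrank F W)
    (τ : ℕ) (hτ : c + k + d + τ ≤ n + 1) (B : Finset (Fin n → F))
    (hB : ∀ α ∈ B, ∃ f : Fin k → Fin d → F, f ≠ 0 ∧ ∀ i, evalAt (α i) f ∈ V i) :
    B.card ≤ n.choose τ * ((d * (k - 1)) ^ τ * Fintype.card F ^ (n - τ)) := by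
  choose H hH using fun i => exists_matrix_ker_eq (V i)
  obtain rfl : V = fun i => LinearMap.ker (H i).mulVecLin := funext fun i => (hH i).symm
  let T : Fin n → (Fin d → RatFunc F) →ₗ[RatFunc F] (Fin d → RatFunc F) :=
    fun i => ((H i).map (algebraMap F (RatFunc F))).mulVecLin
  have : Infinite (RatFunc F) :=
    Infinite.of_injective (algebraMap F[X] (RatFunc F)) (IsFractionRing.injective _ _)
  refine card_solutions_ne_bot_le (K := RatFunc F) (T := T) τ (fun D hD => ?_) B fun α hα => ?_
  · refine exists_solutions_eq_bot T c (fun W => ?_) Dᶜ ?_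
    · refine sum_finrank_ker_inf_le_of_fractionRing H c hV W
    · have h1 : (Dᶜ.card : ℝ) + D.card = n := by
        have := Finset.card_compl_add_card D
        rw [Fintype.card_fin] at this
        exact_mod_cast this
      have h2 : (D.card : ℝ) + 1 ≤ τ := by exact_mod_cast hD
      linarith
  · obtain ⟨f, hf0, hf⟩ := hB α hα
    refine (Submodule.ne_bot_iff _).2
      ⟨fun t a => algebraMap F (RatFunc F) (f t a), mem_solutions.2 fun i _ => ?_, fun h => ?_⟩
    · have h1 : (H i).mulVec (evalAt (α i) f) = 0 := hf i
      have h2 : evalAt (algebraMap F (RatFunc F) (α i))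
          (fun t a => algebraMap F (RatFunc F) (f t a)) =
            algebraMap F (RatFunc F) ∘ evalAt (α i) f := by
        ext a
        simp [evalAt_apply]
      rw [h2]
      ext a
      change ((H i).map (algebraMap F (RatFunc F))).mulVec _ a = 0
      rw [← RingHom.map_mulVec, h1, Pi.zero_apply, map_zero]
    · refine hf0 (funext fun t => funext fun a => ?_)
      have := congrFun (congrFun h t) a
      simpa using this

end Counting

/-! ### Passing to a quotient profile below the threshold rate -/

section Quotient

variable {F : Type*} [Field F] {n b : ℕ}

/-- Rank-nullity for `φ` on `V ⊓ W.comap φ`, which `φ` maps onto `V.map φ ⊓ W`. -/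
lemma finrank_map_inf_add {d : ℕ} (φ : (Fin b → F) →ₗ[F] (Fin d → F))
    (V : Submodule F (Fin b → F)) (W : Submodule F (Fin d → F)) :
    Module.finrank F (V ⊓ LinearMap.ker φ : Submodule F (Fin b → F)) +
        Module.finrank F (V.map φ ⊓ W : Submodule F (Fin d → F)) =
      Module.finrank F (V ⊓ W.comap φ : Submodule F (Fin b → F)) := by
  have h1 : V ⊓ W.comap φ ⊓ LinearMap.ker φ = V ⊓ LinearMap.ker φ := by
    rw [inf_assoc, inf_eq_right.2 (LinearMap.ker_le_comap φ)]
  have h2 : (V ⊓ W.comap φ).map φ = V.map φ ⊓ W := by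
    ext y
    constructor
    · rintro ⟨x, hx, rfl⟩
      exact ⟨Submodule.mem_map_of_mem hx.1, hx.2⟩
    · rintro ⟨⟨x, hx, rfl⟩, hW⟩
      exact ⟨x, ⟨hx, hW⟩, rfl⟩
  rw [← h1, ← h2, finrank_inf_ker_add_finrank_map]

/-- If no subspace that separates the coordinates is better than all its proper subspaces, then
modulo some subspace that does not separate the coordinates, the profile meets every subspace in
small dimension on average. -/
lemma exists_quotient_profile [Finite F] (V : LocalProfile F n b) (c : ℝ)
    (hV : ∀ U ∈ distinctSubspaces F b, ∃ W < U,
      ∑ i, (Module.finrank F (V i ⊓ U : Submodule F (Fin b → F)) : ℝ) - c * Module.finrank F U ≤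
        ∑ i, (Module.finrank F (V i ⊓ W : Submodule F (Fin b → F)) : ℝ) -
          c * Module.finrank F W) :
    ∃ d ≤ b, ∃ φ : (Fin b → F) →ₗ[F] (Fin d → F),
      LinearMap.ker φ ∉ distinctSubspaces F b ∧ ∀ W : Submodule F (Fin d → F),
        ∑ i, (Module.finrank F ((V i).map φ ⊓ W : Submodule F (Fin d → F)) : ℝ) ≤
          c * Module.finrank F W := by
  let g : Submodule F (Fin b → F) → ℝ := fun U =>
    ∑ i, (Module.finrank F (V i ⊓ U : Submodule F (Fin b → F)) : ℝ) - c * Module.finrank F U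
  obtain ⟨U₀, hU₀⟩ := Finite.exists_max g
  -- Minimality among the maximizers keeps `U` from separating the coordinates; maximality, applied
  -- to preimages of `W`, gives the bound in the quotient.
  obtain ⟨U, hU, hmin⟩ := wellFounded_lt.has_min {U | ∀ W, g W ≤ g U} ⟨U₀, hU₀⟩
  let Q := (Fin b → F) ⧸ U
  let e := (Module.finBasis F Q).equivFun
  let φ : (Fin b → F) →ₗ[F] (Fin (Module.finrank F Q) → F) := e.toLinearMap ∘ₗ U.mkQ
  have hker : LinearMap.ker φ = U := by
    rw [LinearEquiv.ker_comp]
    exact U.ker_mkQ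
  have hsurj : LinearMap.range φ = ⊤ := by
    rw [LinearMap.range_eq_top]
    exact e.surjective.comp U.mkQ_surjective
  refine ⟨Module.finrank F Q, by simpa using U.finrank_quotient_le, φ, ?_, fun W => ?_⟩
  · rw [hker]
    intro hdist
    obtain ⟨W, hW, hle⟩ := hV U hdist
    exact hmin W (fun W' => (hU W').trans hle) hW
  · have h1 := hU (W.comap φ)
    have h2 : ∀ i, (Module.finrank F (V i ⊓ W.comap φ : Submodule F (Fin b → F)) : ℝ) =
        Module.finrank F (V i ⊓ U : Submodule F (Fin b → F)) +
          Module.finrank F ((V i).map φ ⊓ W : Submodule F (Fin (Module.finrank F Q) → F)) := by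
      intro i
      rw [← finrank_map_inf_add φ (V i) W, hker]
      push_cast
      rfl
    have h3 : (Module.finrank F (W.comap φ) : ℝ) = Module.finrank F U + Module.finrank F W := by
      have := finrank_map_inf_add φ ⊤ W
      rw [Submodule.map_top, hsurj, top_inf_eq, top_inf_eq, top_inf_eq, hker] at this
      rw [← this]
      push_cast
      rfl
    simp only [g, h2, h3, Finset.sum_add_distrib] at h1
    linarith

/-- Below the threshold rate, every subspace that separates the coordinates has a proper subspace
that is at least as good. -/
lemma exists_lt_of_le_thresholdRate [Finite F] {k : ℕ} {R ε : ℝ} {𝓕 : Set (LocalProfile F n b)}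
    (hR : (R : EReal) ≤ thresholdRate 𝓕 - (ε : EReal)) (hk : (k : ℝ) = R * n) (hn : 0 < n)
    {V : LocalProfile F n b} (hV : V ∈ 𝓕) {U : Submodule F (Fin b → F)}
    (hU : U ∈ distinctSubspaces F b) :
    ∃ W < U,
      ∑ i, (Module.finrank F (V i ⊓ U : Submodule F (Fin b → F)) : ℝ) -
          (n - k - ε * n) * Module.finrank F U ≤
        ∑ i, (Module.finrank F (V i ⊓ W : Submodule F (Fin b → F)) : ℝ) -
          (n - k - ε * n) * Module.finrank F W := by
  have h1 : ((R + ε : ℝ) : EReal) ≤ pairThreshold V U := by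
    have h2 : (R : EReal) + ε ≤ thresholdRate 𝓕 :=
      EReal.add_le_of_le_sub hR
    rw [EReal.coe_add]
    exact h2.trans ((iInf₂_le V hV).trans (iInf₂_le U hU))
  obtain ⟨W, hW, hle⟩ : ∃ W < U, R + ε ≤ rateTerm V U W := by
    by_contra! hlt
    rw [pairThreshold] at h1
    -- Without proper subspaces the supremum is `⊥`, below every real; otherwise finiteness lets it
    -- be attained.
    rcases isEmpty_or_nonempty {W // W < U} with he | hne
    · have : (⨆ (W : Submodule F (Fin b → F)) (_ : W < U), (rateTerm V U W : EReal)) = ⊥ :=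
        eq_bot_iff.2 (iSup₂_le fun W hW => (he.false ⟨W, hW⟩).elim)
      rw [this] at h1
      exact absurd h1 (by simp)
    · obtain ⟨W₀, hW₀⟩ := Finite.exists_max fun W : {W // W < U} => rateTerm V U W.1
      have : (⨆ (W : Submodule F (Fin b → F)) (_ : W < U), (rateTerm V U W : EReal)) ≤
          (rateTerm V U W₀.1 : EReal) :=
        iSup₂_le fun W hW => EReal.coe_le_coe_iff.2 (hW₀ ⟨W, hW⟩)
      have h3 := EReal.coe_le_coe_iff.1 (h1.trans this)
      exact absurd h3 (not_le.2 (hlt W₀.1 W₀.2))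
  refine ⟨W, hW, ?_⟩
  have hdim : (0 : ℝ) < (Module.finrank F U : ℝ) - Module.finrank F W :=
    sub_pos.2 (Nat.cast_lt.2 (Submodule.finrank_lt_finrank_of_lt hW))
  have hn' : (0 : ℝ) < n := Nat.cast_pos.2 hn
  rw [rateTerm, Finset.sum_sub_distrib, le_sub_comm, div_le_iff₀ (mul_pos hn' hdim)] at hle
  rw [hk]
  linarith

end Quotient

/-! ### From matrices in the code to nonzero polynomial vectors -/

section ReedSolomon

variable {F : Type*} [Field F] {k n b d : ℕ}

lemma map_evalAt (φ : (Fin b → F) →ₗ[F] (Fin d → F)) (γ : F) (f : Fin k → Fin b → F) :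
    evalAt γ (fun t => φ (f t)) = φ (evalAt γ f) := by
  simp [evalAt_apply]

/-- A matrix in the Reed–Solomon code is given by a vector of polynomials. -/
lemma exists_evalAt_eq_of_containsMatrix {α : Fin n → F} {A : Matrix (Fin n) (Fin b) F}
    (hA : Code.ContainsMatrix (reedSolomonCode α k) A) :
    ∃ f : Fin k → Fin b → F, ∀ i, evalAt (α i) f = A i := by
  choose p hp hpA using hA
  refine ⟨fun t j => (p j).coeff t, fun i => funext fun j => ?_⟩
  rw [congrFun (hpA j) i, eval_eq_sum, ← sum_fin _ (by simp) (hp j), evalAt_apply]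
  simp [mul_comm]

/-- Two coordinates agree on all of ker φ. If the image under `φ` vanished, every row of the matrix
would lie in ker φ, and the two corresponding columns would coincide. -/
lemma exists_ne_zero_of_containsProfile {α : Fin n → F} {V : LocalProfile F n b}
    (h : Code.ContainsProfile (reedSolomonCode α k) V) (φ : (Fin b → F) →ₗ[F] (Fin d → F))
    (hφ : LinearMap.ker φ ∉ distinctSubspaces F b) :
    ∃ f : Fin k → Fin d → F, f ≠ 0 ∧ ∀ i, evalAt (α i) f ∈ (V i).map φ := by
  obtain ⟨A, hdist, hVA, hCA⟩ := h
  obtain ⟨f, hf⟩ := exists_evalAt_eq_of_containsMatrix hCA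
  refine ⟨fun t => φ (f t), fun h0 => ?_, fun i => ?_⟩
  · simp only [distinctSubspaces, Set.mem_ofPred_eq] at hφ
    push Not at hφ
    obtain ⟨i, j, hij, heq⟩ := hφ
    refine hdist i j hij.ne (funext fun l => heq (A l) ?_)
    rw [LinearMap.mem_ker, ← hf l, ← map_evalAt, h0, map_zero]
  · rw [map_evalAt, hf]
    exact Submodule.mem_map_of_mem (hVA i)

end ReedSolomon

/-! ### Probability and numerical estimates -/

section Probability

lemma measureReal_preimage_le_card_div {A : Type*} [Fintype A] [MeasurableSpace A]
    [DiscreteMeasurableSpace A] {n : ℕ} {Ω : Type*} [MeasurableSpace Ω] (μ : Measure Ω)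
    [IsProbabilityMeasure μ] (α : Fin n → Ω → A) (hα_indep : iIndepFun α μ)
    (hα_unif : ∀ i x, μ {ω | α i ω = x} = (Fintype.card A : ENNReal)⁻¹)
    (B : Finset (Fin n → A)) :
    μ.real {ω | (fun i => α i ω) ∈ B} ≤ B.card / (Fintype.card A : ℝ) ^ n := by
  have hpoint : ∀ a : Fin n → A,
      μ.real {ω | (fun i => α i ω) = a} = ((Fintype.card A : ℝ) ^ n)⁻¹ := by
    intro a
    have hset : {ω | (fun i => α i ω) = a} = ⋂ i ∈ (Finset.univ : Finset (Fin n)),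
        α i ⁻¹' {a i} := by
      ext ω
      simp [funext_iff]
    have h := hα_indep.measure_inter_preimage_eq_mul Finset.univ (sets := fun i => {a i})
      fun i _ => MeasurableSet.singleton _
    have hi : ∀ i, μ (α i ⁻¹' {a i}) = (Fintype.card A : ENNReal)⁻¹ := fun i => hα_unif i (a i)
    rw [measureReal_def, hset, h]
    simp [hi]
  have hset : {ω | (fun i => α i ω) ∈ B} = ⋃ a ∈ B, {ω | (fun i => α i ω) = a} := by
    ext ω
    simp
  rw [hset]
  refine (measureReal_biUnion_finset_le B _).trans ?_
  simp [hpoint, div_eq_mul_inv]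

/-- From t^τ ≤ τ^τ ≤ e^τ τ! and e < 3. A real `t` below `τ` allows for the ceiling. -/
lemma choose_le_three_mul_div_pow (n τ : ℕ) {t : ℝ} (ht : 0 < t) (htτ : t ≤ τ) :
    (n.choose τ : ℝ) ≤ (3 * n / t) ^ τ := by
  have hfac : (0 : ℝ) < (τ.factorial : ℝ) := by exact_mod_cast τ.factorial_pos
  have h1 : (τ : ℝ) ^ τ / τ.factorial ≤ 3 ^ τ := by
    refine (Real.pow_div_factorial_le_exp τ (Nat.cast_nonneg _) τ).trans ?_
    rw [← Real.exp_one_pow]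
    exact pow_le_pow_left₀ (Real.exp_pos _).le Real.exp_one_lt_three.le _
  have h2 : t ^ τ ≤ 3 ^ τ * τ.factorial :=
    (pow_le_pow_left₀ ht.le htτ τ).trans ((div_le_iff₀ hfac).1 h1)
  refine (Nat.choose_le_pow_div τ n).trans ?_
  rw [div_pow, mul_pow, div_le_div_iff₀ hfac (pow_pos ht _)]
  nlinarith [pow_nonneg (Nat.cast_nonneg (α := ℝ) n) τ]

/-- The number of certificates times the probability of a certificate. -/
lemma certificate_bound {n b k d q : ℕ} {ε : ℝ} (hb : 0 < b) (hd : d ≤ b) (hq : 0 < q)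
    (hε : 0 < ε) (hn : 0 < n)
    (hbase : (4 * (b : ℝ)) ^ (4 * b) * k / (ε * q) ≤ 1) :
    ((n.choose ⌈ε * n / (2 * b)⌉₊ * ((d * (k - 1)) ^ ⌈ε * n / (2 * b)⌉₊ *
      q ^ (n - ⌈ε * n / (2 * b)⌉₊)) : ℕ) : ℝ) / (q : ℝ) ^ n ≤
      ((4 * (b : ℝ)) ^ (4 * b) * k / (ε * q)) ^ (ε * n / (2 * b)) := by
  set t := ε * n / (2 * b) with ht
  set τ := ⌈t⌉₊ with hτ
  set x := (4 * (b : ℝ)) ^ (4 * b) * k / (ε * q) with hx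
  have hb' : (1 : ℝ) ≤ b := by exact_mod_cast hb
  have hn' : (0 : ℝ) < n := by exact_mod_cast hn
  have hq' : (0 : ℝ) < q := by exact_mod_cast hq
  have htpos : 0 < t := by positivity
  have htτ : t ≤ τ := Nat.le_ceil _
  have hx0 : 0 ≤ x := by positivity
  -- Rounding the exponent up is free because the base is at most 1.
  have hxt : x ^ τ ≤ x ^ t := by
    rw [← Real.rpow_natCast]
    exact Real.rpow_le_rpow_of_exponent_ge' hx0 hbase htpos.le htτ
  refine le_trans ?_ hxt
  rcases lt_or_ge n τ with hnτ | hnτ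
  · rw [Nat.choose_eq_zero_of_lt hnτ]
    simpa using pow_nonneg hx0 τ
  have hdk : ((d * (k - 1) : ℕ) : ℝ) ≤ b * k := by
    exact_mod_cast Nat.mul_le_mul hd (Nat.sub_le _ _)
  have hqn : (q : ℝ) ^ n = q ^ (n - τ) * q ^ τ := by rw [← pow_add, Nat.sub_add_cancel hnτ]
  have hstep : ((n.choose τ * ((d * (k - 1)) ^ τ * q ^ (n - τ)) : ℕ) : ℝ) / (q : ℝ) ^ n =
      (n.choose τ : ℝ) * (((d * (k - 1) : ℕ) : ℝ) / q) ^ τ := by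
    rw [hqn, div_pow]
    have : (q : ℝ) ^ (n - τ) ≠ 0 := (pow_pos hq' _).ne'
    push_cast
    field_simp
  rw [hstep]
  have h1 : (n.choose τ : ℝ) * (((d * (k - 1) : ℕ) : ℝ) / q) ^ τ ≤
      (3 * n / t) ^ τ * (b * k / q) ^ τ := by
    gcongr
    exact choose_le_three_mul_div_pow n τ htpos htτ
  refine h1.trans ?_
  rw [← mul_pow]
  refine pow_le_pow_left₀ (by positivity) ?_ τ
  -- Only the factor 6b² is needed; (4b)^(4b) dominates it.
  have h2 : 3 * n / t * (b * k / q) = 6 * b ^ 2 * k / (ε * q) := by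
    rw [ht]
    field_simp
    ring
  rw [h2, hx]
  have h3 : 6 * (b : ℝ) ^ 2 ≤ (4 * (b : ℝ)) ^ (4 * b) :=
    calc 6 * (b : ℝ) ^ 2 ≤ (4 * (b : ℝ)) ^ 2 := by nlinarith [sq_nonneg (b : ℝ)]
      _ ≤ (4 * (b : ℝ)) ^ (4 * b) := pow_le_pow_right₀ (by linarith) (by omega)
  gcongr

end Probability

/-! ### One profile, then the union bound over the family -/

/-- The probability that a random Reed–Solomon code below the threshold rate contains a given
profile of the family. -/
theorem measureReal_containsProfile_le
    {𝔽 : Type*} [Field 𝔽] [Fintype 𝔽] [MeasurableSpace 𝔽] [DiscreteMeasurableSpace 𝔽]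
    {n b k : ℕ} {R ε : ℝ} {F : Set (LocalProfile 𝔽 n b)}
    (hR : (R : EReal) ≤ thresholdRate F - (ε : EReal)) (hk : (k : ℝ) = R * n)
    (hε : 2 * (b : ℝ) * (b + 1) ≤ ε * n)
    {Ω : Type*} [MeasurableSpace Ω] (μ : Measure Ω) [IsProbabilityMeasure μ]
    (α : Fin n → Ω → 𝔽) (hα_indep : iIndepFun α μ)
    (hα_unif : ∀ i x, μ {ω | α i ω = x} = (Fintype.card 𝔽 : ENNReal)⁻¹)
    {V : LocalProfile 𝔽 n b} (hV : V ∈ F) :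
    μ.real {ω | Code.ContainsProfile (reedSolomonCode (fun i => α i ω) k) V} ≤
      ((4 * (b : ℝ)) ^ (4 * b) * k / (ε * Fintype.card 𝔽)) ^ (ε * n / (2 * b)) := by
  classical
  -- For b = 0 the zero space is vacuously separating and has no proper subspace, so the threshold
  -- is -∞ and no real `R` lies below it.
  have hb : 0 < b := by
    rcases Nat.eq_zero_or_pos b with rfl | hb
    · have h1 : thresholdRate F ≤ ⊥ := (iInf₂_le V hV).trans
        ((iInf₂_le (⊥ : Submodule 𝔽 (Fin 0 → 𝔽)) fun i => i.elim0).trans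
          (iSup₂_le fun W hW => (not_lt_bot hW).elim))
      rw [le_bot_iff.1 h1, EReal.bot_sub] at hR
      exact absurd (le_bot_iff.1 hR) (EReal.coe_ne_bot _)
    · exact hb
  have hb' : (1 : ℝ) ≤ b := by exact_mod_cast hb
  have hεn : 0 < ε * n := lt_of_lt_of_le (by positivity) hε
  have hn : 0 < n := Nat.pos_of_ne_zero fun h => by simp [h] at hεn
  have hn' : (0 : ℝ) < n := by exact_mod_cast hn
  have hε0 : 0 < ε := pos_of_mul_pos_left hεn hn'.le
  have hq : 0 < Fintype.card 𝔽 := Fintype.card_pos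
  rcases le_or_gt ((4 * (b : ℝ)) ^ (4 * b) * k / (ε * Fintype.card 𝔽)) 1 with hbase | hbase
  swap
  · exact measureReal_le_one.trans (Real.one_le_rpow hbase.le (by positivity))
  obtain ⟨d, hd, φ, hφ, hprof⟩ := exists_quotient_profile V (n - k - ε * n)
    fun U hU => exists_lt_of_le_thresholdRate hR hk hn hV hU
  set τ := ⌈ε * n / (2 * b)⌉₊ with hτ
  let B : Finset (Fin n → 𝔽) := Finset.univ.filter fun a =>
    Code.ContainsProfile (reedSolomonCode a k) V
  -- This amounts to d + τ ≤ εn + 1, which holds as τ < εn/2 + 1 and d ≤ b ≤ εn/2. The spare 1 is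
  -- there because fewer than τ coordinates are dropped.
  have hτle : (n - k - ε * n : ℝ) + k + d + τ ≤ n + 1 := by
    have h1 : (τ : ℝ) < ε * n / (2 * b) + 1 := Nat.ceil_lt_add_one (by positivity)
    have h2 : ε * n / (2 * b) ≤ ε * n / 2 := by
      gcongr
      linarith
    have h3 : (d : ℝ) ≤ b := by exact_mod_cast hd
    nlinarith
  have hcard := card_exists_ne_zero_le (k := k) (fun i => (V i).map φ) _ hprof τ hτle B
    fun a ha => exists_ne_zero_of_containsProfile (Finset.mem_filter.1 ha).2 φ hφ
  have hset : {ω | Code.ContainsProfile (reedSolomonCode (fun i => α i ω) k) V} =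
      {ω | (fun i => α i ω) ∈ B} := by
    ext ω
    simp [B]
  rw [hset]
  refine (measureReal_preimage_le_card_div μ α hα_indep hα_unif B).trans ?_
  refine le_trans ?_ (certificate_bound hb hd hq hε0 hn hbase)
  gcongr

end LCL

theorem mainTheorem4
    {𝔽 : Type*} [Field 𝔽] [Fintype 𝔽] [MeasurableSpace 𝔽] [DiscreteMeasurableSpace 𝔽]
    (n b k : ℕ) (R ε : ℝ)
    (P : LCL.CodeProperty 𝔽 n) (F : Set (LCL.LocalProfile 𝔽 n b))
    (hP : LCL.IsLCLPropertyWith P F)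
    (hR : (R : EReal) ≤ LCL.thresholdRate F - (ε : EReal))
    (hk : (k : ℝ) = R * n)
    (hq : k * b < Fintype.card 𝔽)
    (hε : 2 * (b : ℝ) * (b + 1) ≤ ε * n)
    {Ω : Type*} [MeasurableSpace Ω] (μ : Measure Ω) [IsProbabilityMeasure μ]
    (α : Fin n → Ω → 𝔽) (hα_meas : ∀ i, Measurable (α i))
    (hα_indep : iIndepFun α μ)
    (hα_unif : ∀ i x, μ {ω | α i ω = x} = (Fintype.card 𝔽 : ENNReal)⁻¹) :
    μ.real {ω | LCL.reedSolomonCode (fun i => α i ω) k ∈ P} ≤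
      ((4 * (b : ℝ)) ^ (4 * b) * k / (ε * Fintype.card 𝔽)) ^ (ε * n / (2 * b)) * F.ncard := by
  classical
  have hF : F.Finite := Set.toFinite F
  have hset : {ω | LCL.reedSolomonCode (fun i => α i ω) k ∈ P} =
      ⋃ V ∈ hF.toFinset,
        {ω | LCL.Code.ContainsProfile (LCL.reedSolomonCode (fun i => α i ω) k) V} := by
    rw [hP]
    ext ω
    simp
  rw [hset, Set.ncard_eq_toFinset_card F hF, mul_comm, ← nsmul_eq_mul]
  refine (measureReal_biUnion_finset_le _ _).trans ?_
  exact Finset.sum_le_card_nsmul _ _ _ fun V hV =>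
    LCL.measureReal_containsProfile_le hR hk hε μ α hα_indep hα_unif (hF.mem_toFinset.1 hV)
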